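/- Let $\mathcal{K}=\{x,y,z,w,x',y',z',w',p_1,p_2,p_3,p_4,p_5,p_6\}$ be the set of $14$ points with the partial order generated by the relations $$z,p_5<p_1;\quad p_5,w<p_2;\quad p_6,z<p_3;\quad w,p_6<p_4;\quad p_1,p_2<x;\quad p_3,p_4<y;$$ $$z,w<z';\quad p_5,p_6<w';\quad z',w',p_1,p_4<x';\quad z',w',p_2,p_3<y',$$ and regard $\mathcal{K}$ as a finite $T_0$ topological space whose open sets are the down-sets, that is, the subsets $U$ such that every element smaller than or equal to an element of $U$ belongs to $U$. (This is the core of the space obtained by gluing, along an $8$-point model of $S^1$, the two non-Hausdorff mapping cylinders of maps of degree $1$ and $2$ onto $4$-point models of $S^1$.) Then $\mathcal{K}$ is weak homotopy equivalent to $S^1$, and $\mathcal{K}$ has the fixed point property: every continuous map $f:\mathcal{K}\to\mathcal{K}$ has a fixed point. In particular there exists a topological space weak homotopy equivalent to $S^1$ with the fixed point property. -/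

import Mathlib

open scoped Topology Topology.Homotopy

universe u

/-! ### The fixed point property -/

/-- A topological space has the fixed point property if every continuous self-map of it
has a fixed point. -/
def FixedPointProperty (X : Type u) [TopologicalSpace X] : Prop :=
  ∀ f : C(X, X), ∃ x : X, f x = x

/-! ### Weak homotopy equivalences -/

section WeakHomotopy

variable {X Y : Type u} [TopologicalSpace X] [TopologicalSpace Y]

/-- The map induced by a continuous map on sets of path components. -/
def pathComponentsMap (f : C(X, Y)) : ZerothHomotopy X → ZerothHomotopy Y :=
  ZerothHomotopy.lift (fun x => ZerothHomotopy.mk (f x))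
    (fun _ _ p => ZerothHomotopy.sound (p.map f.continuous))

/-- Composition of a generalized loop `I^n → X` based at `x` with a continuous map. -/
def genLoopMap (f : C(X, Y)) (n : ℕ) (x : X) (p : Ω^ (Fin n) X x) : Ω^ (Fin n) Y (f x) :=
  ⟨f.comp p.1, fun y hy => congrArg f (p.2 y hy)⟩

/-- The map `π_n(X, x) → π_n(Y, f x)` induced by a continuous map `f : X → Y`. -/
def homotopyGroupMap (f : C(X, Y)) (n : ℕ) (x : X) : π_ n X x → π_ n Y (f x) :=
  Quotient.map (genLoopMap f n x) (fun _ _ h => h.comp_continuousMap f)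

/-- A continuous map is a weak homotopy equivalence if it induces a bijection on path components
and, for every base point, bijections on all homotopy groups of positive degree. -/
def IsWeakHomotopyEquivalence (f : C(X, Y)) : Prop :=
  Function.Bijective (pathComponentsMap f) ∧
    ∀ n : ℕ, 1 ≤ n → ∀ x : X, Function.Bijective (homotopyGroupMap f n x)

end WeakHomotopy

/-- Two spaces are weak homotopy equivalent if they are joined by a finite zigzag of weak homotopy
equivalences: the equivalence relation generated by the existence of a weak homotopy
equivalence from one space to the other. -/
def WeakHomotopyEquivalent (X Y : Type u) [TopologicalSpace X] [TopologicalSpace Y] : Prop :=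
  Relation.EqvGen (fun A B : TopCat.{u} => ∃ f : C(A, B), IsWeakHomotopyEquivalence f)
    (TopCat.of X) (TopCat.of Y)

/-! ### The 14-point space

The points `z, p₁, p₅, p₂, w, p₄, p₆, p₃` (in this cyclic order) are an 8-point model of `S¹`, with
minimal points `z, p₅, w, p₆` and maximal points `p₁, p₂, p₄, p₃`. There are two 4-point models of
`S¹`, namely `{x', y', z', w'}`, where `z', w' < x', y'`, and `{x, y, z₀, w₀}`, where
`z₀, w₀ < x, y`. The map

`z ↦ z', p₁ ↦ x', p₅ ↦ w', p₂ ↦ y', w ↦ z', p₄ ↦ x', p₆ ↦ w', p₃ ↦ y'`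

has degree `2` and the map

`z ↦ z₀; p₁, p₅, p₂ ↦ x; w ↦ w₀; p₄, p₆, p₃ ↦ y`

has degree `1`. Glue the non-Hausdorff mapping cylinders of the two maps along the 8-point model
(in a cylinder, `q` is below `t` when the image of `q` is at most `t`). In the resulting 16-point
poset `z` is the largest point below `z₀` and `w` is the largest point below `w₀`; deleting the
beat points `z₀` and `w₀` leaves the core, which is the following 14-point poset. -/

/-- The points of the space; `x'`, `y'`, `z'`, `w'` are the points of a 4-point model of `S¹`. -/
inductive Kun : Type
  | x | y | z | w | x' | y' | z' | w' | p₁ | p₂ | p₃ | p₄ | p₅ | p₆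
  deriving DecidableEq

namespace Kun

instance : Fintype Kun where
  elems := {x, y, z, w, x', y', z', w', p₁, p₂, p₃, p₄, p₅, p₆}
  complete a := by cases a <;> decide

/-- The points which are immediately below a given point (the edges of the Hasse diagram). -/
def lowerCovers : Kun → List Kun
  | z | w | p₅ | p₆ => []
  | p₁ => [z, p₅]
  | p₂ => [p₅, w]
  | p₃ => [p₆, z]
  | p₄ => [w, p₆]
  | x => [p₁, p₂]
  | y => [p₃, p₄]
  | z' => [z, w]
  | w' => [p₅, p₆]
  | x' => [z', w', p₁, p₄]
  | y' => [z', w', p₂, p₃]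

/-- The points which are strictly below a given point. -/
def below : Kun → List Kun
  | z | w | p₅ | p₆ => []
  | p₁ => [z, p₅]
  | p₂ => [p₅, w]
  | p₃ => [p₆, z]
  | p₄ => [w, p₆]
  | x => [p₁, p₂, z, p₅, w]
  | y => [p₃, p₄, z, p₆, w]
  | z' => [z, w]
  | w' => [p₅, p₆]
  | x' => [z', w', p₁, p₄, z, w, p₅, p₆]
  | y' => [z', w', p₂, p₃, z, w, p₅, p₆]

set_option maxRecDepth 100000 in
/-- The partial order on the 14 points. -/
instance : PartialOrder Kun where
  le a b := a = b ∨ a ∈ below b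
  le_refl _ := Or.inl rfl
  le_trans := by decide
  le_antisymm := by decide

instance : DecidableLE Kun := fun a b => inferInstanceAs (Decidable (a = b ∨ a ∈ below b))

/-- The order is the reflexive and transitive closure of the Hasse diagram. -/
theorem le_iff_reflTransGen (a b : Kun) :
    a ≤ b ↔ Relation.ReflTransGen (fun c d => c ∈ lowerCovers d) a b := by
  constructor
  · have key : ∀ a b : Kun, a ≤ b → a = b ∨ a ∈ lowerCovers b ∨
        ∃ c, a ∈ lowerCovers c ∧ c ∈ lowerCovers b := by decide
    intro h
    rcases key a b h with rfl | h | ⟨c, h₁, h₂⟩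
    · exact .refl
    · exact .single h
    · exact (Relation.ReflTransGen.single h₁).tail h₂
  · intro h
    induction h with
    | refl => exact le_refl a
    | tail _ h ih =>
      have key : ∀ c d : Kun, c ∈ lowerCovers d → c ≤ d := by decide
      exact ih.trans (key _ _ h)

/-- The topology of the finite space: the open sets are the lower sets (down-sets). -/
instance : TopologicalSpace Kun := Topology.lowerSet Kun

end Kun

/-! Continuous self-maps of a finite space with the down-set topology are the monotone maps, so the
fixed point property is a finite check: a kernel-evaluated backtracking search finds no
fixed-point-free monotone map.

For the weak equivalence, `Kun.ofCircle` maps the circle onto the 4-point model `{x', y', z', w'}`.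
The points `x` and `y` are maximal, and what lies strictly below either of them is contractible, so
both can be discarded; the rest retracts onto the model by a monotone map above the identity. No
homotopy theory of posets is needed: these deformations are applied to an arbitrary map `g : T →
Kun`, relative to a closed set where `g` already lifts to the circle
(`ContinuousMap.exists_homotopicRel_ne`, `Kun.toModel`). The resulting map into the model lifts by
an explicit formula (`Kun.exists_lift_circle`). Relative lifting over cubes and over their products
with the interval gives the bijections on homotopy groups. -/

/-! ### Searching for monotone maps -/

section MonotoneSearch

variable {α : Type*} [Preorder α] [DecidableLE α]

/-- Backtracking search, with forward checking, for a monotone map: each entry `(a, l)` of the list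
prescribes that the value at `a` belongs to `l`. The result `false` means that there is none. -/
def monotoneSearch : ℕ → List (α × List α) → Bool
  | 0, _ => true
  | _ + 1, [] => true
  | n + 1, (a, l) :: rest => l.any fun v =>
      let pruned := rest.map fun q =>
        (q.1, q.2.filter fun u => decide ((a ≤ q.1 → v ≤ u) ∧ (q.1 ≤ a → u ≤ v)))
      pruned.all (fun q => !q.2.isEmpty) && monotoneSearch n pruned

/-- The values of `f` survive every pruning. Running out of fuel counts as success, so the answer
`false` is conclusive for every `n`. -/
theorem monotoneSearch_eq_true {f : α → α} (hf : Monotone f) (n : ℕ) (L : List (α × List α))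
    (hL : ∀ q ∈ L, f q.1 ∈ q.2) : monotoneSearch n L = true := by
  induction n generalizing L with
  | zero => rfl
  | succ n ih =>
    match L with
    | [] => rfl
    | (a, l) :: rest =>
      have key : ∀ q ∈ rest.map (fun q => (q.1, q.2.filter fun u =>
          decide ((a ≤ q.1 → f a ≤ u) ∧ (q.1 ≤ a → u ≤ f a)))), f q.1 ∈ q.2 := by
        intro q hq
        obtain ⟨q', hq', rfl⟩ := List.mem_map.1 hq
        exact List.mem_filter.2 ⟨hL _ (List.mem_cons_of_mem _ hq'),
          decide_eq_true ⟨fun h => hf h, fun h => hf h⟩⟩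
      refine List.any_eq_true.2 ⟨f a, hL (a, l) List.mem_cons_self, ?_⟩
      refine (Bool.and_eq_true _ _).symm ▸ ⟨List.all_eq_true.2 fun q hq => ?_, ih _ key⟩
      have := List.ne_nil_of_mem (key q hq)
      simpa using this

end MonotoneSearch

/-! ### The fixed point property of the 14-point space -/

namespace Kun

instance : Topology.IsLowerSet Kun := ⟨rfl⟩

/-- Each point is removed from its own candidate list, which encodes the absence of fixed points.
The fuel is the number of points, so no branch is cut short. -/
theorem monotoneSearch_eq_false :
    monotoneSearch 14 ([z', p₁, p₂, p₄, p₃, w', y', w, y, p₅, p₆, z, x', x].map fun a =>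
      (a, [x, y, z, w, x', y', z', w', p₁, p₂, p₃, p₄, p₅, p₆].filter (· ≠ a))) = false := by
  decide +kernel

theorem fixedPointProperty : FixedPointProperty Kun := by
  intro f
  by_contra! h
  have hf : Monotone f := Topology.IsLowerSet.monotone_iff_continuous.2 f.continuous
  refine Bool.false_ne_true (monotoneSearch_eq_false.symm.trans
    (monotoneSearch_eq_true hf 14 _ fun q hq => ?_))
  obtain ⟨a, -, rfl⟩ := List.mem_map.1 hq
  refine List.mem_filter.2 ⟨?_, decide_eq_true (h a)⟩
  cases f a <;> simp

end Kun

/-! ### A lifting criterion for weak homotopy equivalences -/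

section RelativeLifts

open unitInterval

variable {X Y : Type u} [TopologicalSpace X] [TopologicalSpace Y]

/-- A continuous map `f : X → Y` has relative lifts if, for every closed subset `D` of a metric
space `T`, every map `g : T → Y` with a lift to `X` over `D` is homotopic relative to `D` to a map
with a lift extending the given one. -/
def HasRelativeLifts (f : C(X, Y)) : Prop :=
  ∀ (T : Type) [MetricSpace T] (D : Set T), IsClosed D → ∀ (g : C(T, Y)) (l : T → X),
    ContinuousOn l D → (∀ t ∈ D, f (l t) = g t) →
      ∃ v : C(T, X), Set.EqOn v l D ∧ (f.comp v).HomotopicRel g D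

/-- A homotopy relative to `S` after composition with a map with relative lifts comes from a
homotopy relative to `S`. -/
theorem HasRelativeLifts.homotopicRel_of_comp {f : C(X, Y)} (hf : HasRelativeLifts f)
    {T : Type} [MetricSpace T] {S : Set T} (hS : IsClosed S) {p q : C(T, X)}
    (hpq : Set.EqOn p q S) (h : (f.comp p).HomotopicRel (f.comp q) S) : p.HomotopicRel q S := by
  obtain ⟨H⟩ := h
  -- Lifting is applied on `I × T`, over both ends and `I × S`. The prescribed lift is `p` at time 0
  -- and `q` at time 1, and their common value over `S`.
  let l : I × T → X := fun a => if a.1 = 1 then q a.2 else p a.2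
  have h₀ : IsClosed {a : I × T | a.1 = 0} := isClosed_singleton.preimage continuous_fst
  have h₁ : IsClosed {a : I × T | a.1 = 1} := isClosed_singleton.preimage continuous_fst
  have hS' : IsClosed {a : I × T | a.2 ∈ S} := hS.preimage continuous_snd
  have l₀ : Set.EqOn l (fun a => p a.2) ({a : I × T | a.1 = 0} ∪ {a | a.2 ∈ S}) := by
    rintro ⟨s, t⟩ (h | h)
    · obtain rfl : s = 0 := h
      simp [l]
    · have := hpq h
      simp only [l]
      split_ifs <;> simp_all
  have l₁ : Set.EqOn l (fun a => q a.2) {a : I × T | a.1 = 1} := fun a h => if_pos h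
  have hl : ContinuousOn l
      (({a : I × T | a.1 = 0} ∪ {a | a.2 ∈ S}) ∪ {a : I × T | a.1 = 1}) :=
    ContinuousOn.union_of_isClosed
      ((Continuous.continuousOn (by fun_prop)).congr l₀)
      ((Continuous.continuousOn (by fun_prop)).congr l₁) (h₀.union hS') h₁
  obtain ⟨v, hv, -⟩ := hf (I × T) _ ((h₀.union hS').union h₁) H.toContinuousMap l hl (by
    rintro ⟨s, t⟩ (h | h)
    · rw [l₀ h]
      rcases h with h | h
      · obtain rfl : s = 0 := h
        exact (H.apply_zero t).symm
      · exact (H.eq_fst s h).symm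
    · rw [l₁ h]
      obtain rfl : s = 1 := h
      exact (H.apply_one t).symm)
  refine ⟨⟨⟨v, fun t => ?_, fun t => ?_⟩, fun s t ht => ?_⟩⟩
  · exact (hv (Or.inl (Or.inl rfl))).trans (l₀ (Or.inl rfl))
  · exact (hv (Or.inr rfl)).trans (l₁ rfl)
  · exact (hv (Or.inl (Or.inr ht))).trans (l₀ (Or.inr ht))

theorem isClosed_cube_boundary (n : ℕ) : IsClosed (Cube.boundary (Fin n)) := by
  have : Cube.boundary (Fin n) = ⋃ i, ({y | y i = 0} ∪ {y | y i = 1}) := by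
    ext y
    simp [Cube.boundary]
  rw [this]
  exact isClosed_iUnion_of_finite fun i =>
    (isClosed_singleton.preimage (continuous_apply i)).union
      (isClosed_singleton.preimage (continuous_apply i))

theorem HasRelativeLifts.isWeakHomotopyEquivalence [Nonempty X] {f : C(X, Y)} (hf : HasRelativeLifts f) :
    IsWeakHomotopyEquivalence f := by
  refine ⟨⟨?_, ?_⟩, fun n _ x => ⟨?_, ?_⟩⟩
  · intro a b h
    induction a with | mk a => ?_
    induction b with | mk b => ?_
    obtain ⟨γ⟩ : Joined (f a) (f b) := Quotient.exact h
    -- A path is a homotopy between maps from a one-point space.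
    have hγ : (f.comp (.const Unit a)).HomotopicRel (f.comp (.const Unit b)) ∅ :=
      ⟨⟨⟨⟨fun s => γ s.1, by fun_prop⟩, fun _ => γ.source, fun _ => γ.target⟩,
        fun _ _ h => h.elim⟩⟩
    obtain ⟨H⟩ := hf.homotopicRel_of_comp isClosed_empty (Set.eqOn_empty _ _) hγ
    exact ZerothHomotopy.sound (H.toHomotopy.evalAt ())
  · intro b
    induction b with | mk b => ?_
    obtain ⟨v, -, ⟨H⟩⟩ := hf PUnit ∅ isClosed_empty (.const _ b)
      (fun _ => Classical.arbitrary X) (by simp) (by simp)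
    exact ⟨.mk (v ()), ZerothHomotopy.sound (H.toHomotopy.evalAt ())⟩
  · intro a b h
    induction a using Quotient.inductionOn with | _ p => ?_
    induction b using Quotient.inductionOn with | _ q => ?_
    have h' : GenLoop.Homotopic (genLoopMap f n x p) (genLoopMap f n x q) := Quotient.exact h
    exact Quotient.sound (hf.homotopicRel_of_comp (isClosed_cube_boundary n)
      (fun y hy => (p.2 y hy).trans (q.2 y hy).symm) h')
  · intro b
    induction b using Quotient.inductionOn with | _ q => ?_
    obtain ⟨v, hv, H⟩ := hf _ _ (isClosed_cube_boundary n) q.1 (fun _ => x)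
      continuousOn_const (fun y hy => (q.2 y hy).symm)
    exact ⟨Quotient.mk _ ⟨v, hv⟩, Quotient.sound H⟩

end RelativeLifts

/-! ### Maps to spaces whose open sets are the lower sets -/

section LowerSet

open unitInterval

variable {T P : Type*} [TopologicalSpace T] [TopologicalSpace P]

theorem continuous_iff_eventually_le [Preorder P] [Topology.IsLowerSet P] {g : T → P} :
    Continuous g ↔ ∀ t, ∀ᶠ s in 𝓝 t, g s ≤ g t := by
  simp only [continuous_iff_continuousAt, ContinuousAt, Topology.IsLowerSet.nhds_eq_principal_Iic,
    Filter.tendsto_principal, Set.mem_Iic]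

theorem ContinuousMap.eventually_le [Preorder P] [Topology.IsLowerSet P] (g : C(T, P)) (t : T) :
    ∀ᶠ s in 𝓝 t, g s ≤ g t :=
  continuous_iff_eventually_le.1 g.continuous t

theorem ContinuousMap.isOpen_preimage_Iic [Preorder P] [Topology.IsLowerSet P] (g : C(T, P))
    (a : P) : IsOpen (g ⁻¹' Set.Iic a) :=
  (Topology.IsLowerSet.isOpen_iff_isLowerSet.2 (isLowerSet_Iic a)).preimage g.continuous

theorem ContinuousMap.isClosed_setOf_eq_of_isMax [PartialOrder P] [Topology.IsLowerSet P]
    (g : C(T, P)) {a : P} (ha : IsMax a) : IsClosed {t | g t = a} := by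
  have : {t | g t = a} = g ⁻¹' Set.Ici a := by
    ext t
    exact ⟨fun h => h.ge, fun h => ha.eq_of_ge h⟩
  rw [this]
  exact (Topology.IsLowerSet.isClosed_iff_isUpper.2 (isUpperSet_Ici a)).preimage g.continuous

/-- Comparable maps are homotopic relative to the set where they agree. -/
theorem ContinuousMap.homotopicRel_of_le [Preorder P] [Topology.IsLowerSet P] {g h : C(T, P)} {D : Set T}
    (hgh : ∀ t, g t ≤ h t) (hD : Set.EqOn g h D) : g.HomotopicRel h D := by
  classical
  -- Values may only drop near a point, so the larger map `h` is used on the closed slice at time 1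
  -- and `g` before it.
  refine ⟨⟨⟨⟨fun a : I × T => if a.1 = 1 then h a.2 else g a.2, ?_⟩, fun t => ?_, fun t => ?_⟩,
    fun s t ht => ?_⟩⟩
  · refine continuous_iff_eventually_le.2 fun ⟨s, t⟩ => ?_
    by_cases hs : s = 1
    · filter_upwards [continuous_snd.continuousAt.eventually (h.eventually_le t)] with a ha
      simp only [hs, if_true]
      split_ifs
      · exact ha
      · exact (hgh _).trans ha
    · filter_upwards [continuous_snd.continuousAt.eventually (g.eventually_le t),
        continuous_fst.continuousAt.eventually (isOpen_ne.mem_nhds hs)] with a ha ha'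
      simpa [hs, ha'] using ha
  · simp
  · simp
  · have := hD ht
    by_cases hs : s = 1 <;> simp [hs, this]

/-- If the set of points below a maximal point `a` contracts, through an increasing map `r` above a
constant `c`, then every map can be deformed off `a`, without changing it on a closed set which
is already disjoint from the fibre over `a`. -/
theorem ContinuousMap.exists_homotopicRel_ne [NormalSpace T] [PartialOrder P] [Topology.IsLowerSet P]
    {a c : P} {r : P → P} (ha : IsMax a) (hc : c < a)
    (hr : ∀ b < a, b ≤ r b ∧ c ≤ r b ∧ r b < a) (hmono : ∀ b < a, ∀ b' ≤ b, r b' ≤ r b)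
    (g : C(T, P)) {D : Set T} (hD : IsClosed D) (hgD : ∀ t ∈ D, g t ≠ a) :
    ∃ g' : C(T, P), g'.HomotopicRel g D ∧ (∀ t, g' t ≠ a) ∧
      ∀ t, g' t = g t ∨ g' t = c ∨ g t < a ∧ g' t = r (g t) := by
  classical
  have hK := g.isClosed_setOf_eq_of_isMax ha
  have hO := g.isOpen_preimage_Iic a
  obtain ⟨V, hV, hKV, hVO⟩ := normal_exists_closure_subset hK (hO.inter hD.isOpen_compl)
    (fun t (ht : g t = a) => ⟨ht.le, fun htD => hgD t htD ht⟩)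
  have hlt : ∀ t, t ∈ closure V → t ∉ V → g t < a := fun t ht htV =>
    lt_of_le_of_ne (hVO ht).1 fun h => htV (hKV h)
  have hNc : ∀ t, t ∉ closure V → ∀ᶠ s in 𝓝 t, s ∉ closure V := fun t ht =>
    isClosed_closure.isOpen_compl.mem_nhds ht
  have hgO : ∀ t ∈ closure V, ∀ᶠ s in 𝓝 t, g s ≤ a := fun t ht => hO.mem_nhds (hVO ht).1
  -- On the frontier of `V`, the value `r (g t)` dominates both neighbouring regimes, `c` inside and
  -- `g` outside; this is what makes `g'` continuous.
  let g' : C(T, P) := ⟨fun t => if t ∈ V then c else if t ∈ closure V then r (g t) else g t, by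
    refine continuous_iff_eventually_le.2 fun t => ?_
    by_cases htV : t ∈ V
    · filter_upwards [hV.mem_nhds htV] with s hs
      rw [if_pos hs, if_pos htV]
    by_cases htN : t ∈ closure V
    · filter_upwards [g.eventually_le t] with s hs
      have h := hr _ (hlt t htN htV)
      rw [if_neg htV, if_pos htN]
      split_ifs
      · exact h.2.1
      · exact hmono _ (hlt t htN htV) _ hs
      · exact hs.trans h.1
    · filter_upwards [g.eventually_le t, hNc t htN] with s hs hsN
      rwa [if_neg htV, if_neg htN, if_neg fun h => hsN (subset_closure h), if_neg hsN]⟩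
  -- A common upper bound of `g` and `g'`, equal to both on `D`: two comparisons give the homotopy.
  let h : C(T, P) := ⟨fun t => if t ∈ closure V then a else g t, by
    refine continuous_iff_eventually_le.2 fun t => ?_
    by_cases htN : t ∈ closure V
    · filter_upwards [hgO t htN] with s hs
      rw [if_pos htN]
      split_ifs
      · exact le_rfl
      · exact hs
    · filter_upwards [g.eventually_le t, hNc t htN] with s hs hsN
      rwa [if_neg htN, if_neg hsN]⟩
  have hg' : ∀ t, g' t = if t ∈ V then c else if t ∈ closure V then r (g t) else g t :=
    fun _ => rfl
  have hh : ∀ t, h t = if t ∈ closure V then a else g t := fun _ => rfl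
  have hDN : ∀ t ∈ D, t ∉ closure V := fun t ht htN => (hVO htN).2 ht
  have hDV : ∀ t ∈ D, t ∉ V := fun t ht htV => hDN t ht (subset_closure htV)
  refine ⟨g', ?_, fun t => ?_, fun t => ?_⟩
  · refine (homotopicRel_of_le (h := h) (fun t => ?_) fun t ht => ?_).trans
      (homotopicRel_of_le (h := h) (fun t => ?_) fun t ht => ?_).symm
    · rw [hg', hh]
      split_ifs with h₁ h₂ h₂
      · exact hc.le
      · exact absurd (subset_closure h₁) h₂
      · exact (hr _ (hlt t h₂ h₁)).2.2.le
      · exact le_rfl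
    · rw [hg', hh, if_neg (hDV t ht), if_neg (hDN t ht), if_neg (hDN t ht)]
    · rw [hh]
      split_ifs with h₁
      · exact (hVO h₁).1
      · exact le_rfl
    · rw [hh, if_neg (hDN t ht)]
  · rw [hg']
    split_ifs with h₁ h₂
    · exact hc.ne
    · exact (hr _ (hlt t h₂ h₁)).2.2.ne
    · exact fun h => h₁ (hKV h)
  · rw [hg']
    split_ifs with h₁ h₂
    · exact Or.inr (Or.inl rfl)
    · exact Or.inr (Or.inr ⟨hlt t h₂ h₁, rfl⟩)
    · exact Or.inl rfl

end LowerSet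

/-! ### The map from the circle -/

/-- A continuous function to `[-1, 1]` on a closed subset of a metric space has an extension whose
values outside of the subset are in `(-1, 1)`. -/
theorem exists_extension_abs_lt_one {T : Type*} [MetricSpace T] {C : Set T} (hC : IsClosed C)
    {r : T → ℝ} (hr : ContinuousOn r C) (hr₁ : ∀ t ∈ C, |r t| ≤ 1) :
    ∃ ρ : C(T, ℝ), Set.EqOn ρ r C ∧ (∀ t, |ρ t| ≤ 1) ∧ ∀ t ∉ C, |ρ t| < 1 := by
  -- `Metric.infDist` to the empty set is 0, so the damping below would have no effect.
  rcases C.eq_empty_or_nonempty with rfl | hne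
  · exact ⟨.const T 0, Set.eqOn_empty _ _, by simp, by simp⟩
  obtain ⟨σ, hσ⟩ := ContinuousMap.exists_restrict_eq hC ⟨C.domRestrict r, hr.domRestrict⟩
  have hσ' : ∀ t ∈ C, σ t = r t := fun t ht => congr($hσ ⟨t, ht⟩)
  have hcl : ∀ t, |max (-1) (min 1 (σ t))| ≤ 1 := fun t =>
    abs_le.2 ⟨le_max_left _ _, max_le (by norm_num) (min_le_left _ _)⟩
  have hpos : ∀ t, 0 < 1 + Metric.infDist t C := fun t => by
    have := Metric.infDist_nonneg (x := t) (s := C)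
    linarith
  -- The Tietze extension is clamped to `[-1, 1]`, then damped by a factor that is trivial exactly
  -- on `C`.
  refine ⟨⟨fun t => max (-1) (min 1 (σ t)) / (1 + Metric.infDist t C), ?_⟩, fun t ht => ?_,
    fun t => ?_, fun t ht => ?_⟩
  · exact Continuous.div (by fun_prop)
      (continuous_const.add (Metric.continuous_infDist_pt C)) fun t => (hpos t).ne'
  · have := abs_le.1 (hr₁ t ht)
    simp [hσ' t ht, Metric.infDist_zero_of_mem ht, this.1, this.2]
  · rw [ContinuousMap.coe_mk, abs_div, abs_of_pos (hpos t), div_le_one (hpos t)]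
    have := Metric.infDist_nonneg (x := t) (s := C)
    linarith [hcl t]
  · rw [ContinuousMap.coe_mk, abs_div, abs_of_pos (hpos t), div_lt_one (hpos t)]
    have := (hC.notMem_iff_infDist_pos hne).1 ht
    linarith [hcl t]

namespace Circle

theorem re_sq_add_im_sq (c : Circle) : (c : ℂ).re ^ 2 + (c : ℂ).im ^ 2 = 1 := by
  have := c.normSq_coe
  rw [Complex.normSq_apply] at this
  linarith

end Circle

namespace Kun

open Classical in
/-- The map from the circle onto the 4-point model `{x', y', z', w'}` of the circle, which sends the
open upper and lower half circles to `z'` and `w'`. -/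
noncomputable def ofCircle : C(Circle, Kun) where
  toFun c := if 0 < (c : ℂ).im then z' else if (c : ℂ).im < 0 then w' else
    if 0 < (c : ℂ).re then x' else y'
  continuous_toFun := by
    have him : Continuous fun c : Circle => (c : ℂ).im := by fun_prop
    have hre : Continuous fun c : Circle => (c : ℂ).re := by fun_prop
    refine continuous_iff_eventually_le.2 fun c => ?_
    rcases lt_trichotomy 0 (c : ℂ).im with h | h | h
    · filter_upwards [him.continuousAt.eventually (lt_mem_nhds h)] with d hd
      rw [if_pos h, if_pos hd]
    · rcases lt_or_ge 0 (c : ℂ).re with h' | h'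
      · filter_upwards [hre.continuousAt.eventually (lt_mem_nhds h')] with d hd
        rw [if_neg h.not_lt, if_neg h.not_gt, if_pos h', if_pos hd]
        split_ifs <;> decide
      · have h'' : (c : ℂ).re < 0 := by
          refine lt_of_le_of_ne h' fun h'' => ?_
          have := c.re_sq_add_im_sq
          rw [h'', ← h] at this
          norm_num at this
        filter_upwards [hre.continuousAt.eventually (gt_mem_nhds h'')] with d hd
        rw [if_neg h.not_lt, if_neg h.not_gt, if_neg h'.not_gt, if_neg hd.not_gt]
        split_ifs <;> decide
    · filter_upwards [him.continuousAt.eventually (gt_mem_nhds h)] with d hd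
      rw [if_neg h.not_gt, if_pos h, if_neg hd.not_gt, if_pos hd]

theorem ofCircle_eq_z'_iff {c : Circle} : ofCircle c = z' ↔ 0 < (c : ℂ).im := by
  simp only [ofCircle, ContinuousMap.coe_mk]
  split_ifs <;> simp_all

theorem ofCircle_eq_w'_iff {c : Circle} : ofCircle c = w' ↔ (c : ℂ).im < 0 := by
  simp only [ofCircle, ContinuousMap.coe_mk]
  split_ifs with h₁ <;> simp_all
  exact h₁.le

theorem ofCircle_eq_x'_iff {c : Circle} : ofCircle c = x' ↔ (c : ℂ).re = 1 := by
  have := c.re_sq_add_im_sq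
  simp only [ofCircle, ContinuousMap.coe_mk]
  constructor
  · split_ifs with h₁ h₂ h₃ <;> simp
    nlinarith
  · intro h
    have h' : (c : ℂ).im = 0 := by rw [h] at this; nlinarith
    simp [h, h']

theorem ofCircle_eq_y'_iff {c : Circle} : ofCircle c = y' ↔ (c : ℂ).re = -1 := by
  have := c.re_sq_add_im_sq
  simp only [ofCircle, ContinuousMap.coe_mk]
  constructor
  · split_ifs with h₁ h₂ h₃ <;> simp
    have : (c : ℂ).im = 0 := by linarith
    nlinarith
  · intro h
    have h' : (c : ℂ).im = 0 := by rw [h] at this; nlinarith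
    norm_num [h, h']

theorem isMax_of_mem {a : Kun} (ha : a ∈ [x, y, x', y']) : IsMax a := by
  have : ∀ a ∈ [x, y, x', y'], ∀ b, a ≤ b → b ≤ a := by decide
  exact fun b => this a ha b

/-- A map onto the 4-point model of the circle lifts to the circle, relative to a given lift over a
closed set. -/
theorem exists_lift_circle {T : Type*} [MetricSpace T] {D : Set T} (hD : IsClosed D)
    (g : C(T, Kun)) (hg : ∀ t, g t = x' ∨ g t = y' ∨ g t = z' ∨ g t = w') {l : T → Circle}
    (hl : ContinuousOn l D) (hlg : ∀ t ∈ D, ofCircle (l t) = g t) :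
    ∃ v : C(T, Circle), Set.EqOn v l D ∧ ofCircle.comp v = g := by
  have hx : IsClosed {t | g t = x'} := g.isClosed_setOf_eq_of_isMax (isMax_of_mem (by decide))
  have hy : IsClosed {t | g t = y'} := g.isClosed_setOf_eq_of_isMax (isMax_of_mem (by decide))
  -- The real part of the lift is forced over `x'`, `y'` and `D`; elsewhere it must stay strictly
  -- between -1 and 1.
  let r : T → ℝ := fun t => if g t = x' then 1 else if g t = y' then -1 else (l t : ℂ).re
  have hrx : Set.EqOn r (fun _ => 1) {t | g t = x'} := fun t ht => if_pos ht
  have hry : Set.EqOn r (fun _ => -1) {t | g t = y'} := fun t (ht : g t = y') => by simp [r, ht]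
  have hrD : Set.EqOn r (fun t => (l t : ℂ).re) D := fun t ht => by
    have := hlg t ht
    simp only [r]
    split_ifs with h₁ h₂
    · exact (ofCircle_eq_x'_iff.1 (this.trans h₁)).symm
    · exact (ofCircle_eq_y'_iff.1 (this.trans h₂)).symm
    · rfl
  obtain ⟨ρ, hρ, hρ₁, hρ₂⟩ := exists_extension_abs_lt_one ((hx.union hy).union hD) (r := r)
    (((continuousOn_const.congr hrx).union_of_isClosed (continuousOn_const.congr hry) hx
      hy).union_of_isClosed (ContinuousOn.congr (by fun_prop) hrD) (hx.union hy) hD)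
    (by
      rintro t -
      simp only [r]
      split_ifs
      · simp
      · simp
      · have := (l t).re_sq_add_im_sq
        exact abs_le_one_iff_mul_self_le_one.2 (by nlinarith))
  have hρx : ∀ t, g t = x' → ρ t = 1 := fun t ht => (hρ (Or.inl (Or.inl ht))).trans (hrx ht)
  have hρy : ∀ t, g t = y' → ρ t = -1 := fun t ht => (hρ (Or.inl (Or.inr ht))).trans (hry ht)
  have hρD : ∀ t ∈ D, ρ t = (l t : ℂ).re := fun t ht => (hρ (Or.inr ht)).trans (hrD ht)
  have hρlt : ∀ t, g t ≠ x' → g t ≠ y' → 0 < 1 - ρ t ^ 2 := by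
    intro t h₁ h₂
    by_cases ht : t ∈ D
    · have h := (l t).re_sq_add_im_sq
      have h' : (l t : ℂ).im ≠ 0 := by
        have := hlg t ht
        rcases hg t with h | h | h | h
        · exact absurd h h₁
        · exact absurd h h₂
        · exact (ofCircle_eq_z'_iff.1 (this.trans h)).ne'
        · exact (ofCircle_eq_w'_iff.1 (this.trans h)).ne
      rw [hρD t ht]
      have := pow_pos (abs_pos.2 h') 2
      rw [sq_abs] at this
      linarith
    · have := (sq_lt_one_iff_abs_lt_one (ρ t)).2 (hρ₂ t (by simp [h₁, h₂, ht]))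
      linarith
  have hρle : ∀ t, 0 ≤ 1 - ρ t ^ 2 := fun t => by
    have := (sq_le_one_iff_abs_le_one (ρ t)).2 (hρ₁ t)
    linarith
  -- The real part fixes the imaginary part up to sign, and `z'` or `w'` selects the sign. The two
  -- branches meet over `x'` and `y'`, where both vanish.
  let i : T → ℝ := fun t => if g t = w' then -√(1 - ρ t ^ 2) else √(1 - ρ t ^ 2)
  have hisq : ∀ t, i t ^ 2 = 1 - ρ t ^ 2 := fun t => by
    simp only [i]
    split_ifs <;> simp [Real.sq_sqrt (hρle t)]
  have hz : IsClosed {t | g t ≠ z'} := by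
    convert (g.isOpen_preimage_Iic z').isClosed_compl using 1
    ext t
    rcases hg t with h | h | h | h <;> simp [h] <;> decide
  have hw : IsClosed {t | g t ≠ w'} := by
    convert (g.isOpen_preimage_Iic w').isClosed_compl using 1
    ext t
    rcases hg t with h | h | h | h <;> simp [h] <;> decide
  have hi : Continuous i := by
    have h₁ : ContinuousOn i {t | g t ≠ w'} :=
      (Continuous.continuousOn (by fun_prop)).congr (f := fun t => √(1 - ρ t ^ 2))
        fun t ht => if_neg ht
    have h₂ : ContinuousOn i {t | g t ≠ z'} :=
      (Continuous.continuousOn (by fun_prop)).congr (f := fun t => -√(1 - ρ t ^ 2))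
        fun t ht => by
          rcases hg t with h | h | h | h
          · simp [i, h, hρx t h]
          · simp [i, h, hρy t h]
          · exact absurd h ht
          · simp [i, h]
    have huniv : {t | g t ≠ w'} ∪ {t | g t ≠ z'} = Set.univ := by
      ext t
      by_cases h : g t = w' <;> simp [h]
    exact continuousOn_univ.1 (huniv ▸ h₁.union_of_isClosed h₂ hw hz)
  have hsphere : ∀ t, (⟨ρ t, i t⟩ : ℂ) ∈ Submonoid.unitSphere ℂ := fun t =>
    mem_sphere_zero_iff_norm.2 <| by
      rw [← sq_eq_sq₀ (norm_nonneg _) zero_le_one, ← Complex.normSq_eq_norm_sq,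
        Complex.normSq_apply]
      linarith [hisq t]
  have hcont : Continuous fun t => (⟨ρ t, i t⟩ : ℂ) :=
    Complex.equivRealProdCLM.symm.continuous.comp (ρ.continuous.prodMk hi)
  have hiz : ∀ t, g t = z' → 0 < i t := fun t ht => by
    simp only [i, ht, reduceCtorEq, if_false]
    exact Real.sqrt_pos.2 (hρlt t (by simp [ht]) (by simp [ht]))
  have hiw : ∀ t, g t = w' → i t < 0 := fun t ht => by
    simp only [i, ht, if_true, neg_lt_zero]
    exact Real.sqrt_pos.2 (hρlt t (by simp [ht]) (by simp [ht]))
  refine ⟨⟨fun t => ⟨⟨ρ t, i t⟩, hsphere t⟩, hcont.subtype_mk _⟩, fun t ht => ?_, ?_⟩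
  · refine Circle.ext (Complex.ext (hρD t ht) (?_ : i t = (l t : ℂ).im))
    have h₁ : i t ^ 2 = (l t : ℂ).im ^ 2 := by
      rw [hisq, hρD t ht]
      linarith [(l t).re_sq_add_im_sq]
    have h₂ := hlg t ht
    rcases hg t with h | h | h | h
    · have := hisq t
      rw [hρx t h] at this
      rw [pow_eq_zero_iff two_ne_zero |>.1 (h₁.symm.trans (by linarith)),
        pow_eq_zero_iff two_ne_zero |>.1 (this.trans (by norm_num))]
    · have := hisq t
      rw [hρy t h] at this
      rw [pow_eq_zero_iff two_ne_zero |>.1 (h₁.symm.trans (by linarith)),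
        pow_eq_zero_iff two_ne_zero |>.1 (this.trans (by norm_num))]
    · have h₃ := ofCircle_eq_z'_iff.1 (h₂.trans h)
      exact (sq_eq_sq₀ (hiz t h).le h₃.le).1 h₁
    · have h₃ := ofCircle_eq_w'_iff.1 (h₂.trans h)
      have := hiw t h
      rcases sq_eq_sq_iff_eq_or_eq_neg.1 h₁ with h₄ | h₄
      · exact h₄
      · linarith
  · ext t
    rcases hg t with h | h | h | h
    · exact (ofCircle_eq_x'_iff.2 (hρx t h)).trans h.symm
    · exact (ofCircle_eq_y'_iff.2 (hρy t h)).trans h.symm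
    · exact (ofCircle_eq_z'_iff.2 (hiz t h)).trans h.symm
    · exact (ofCircle_eq_w'_iff.2 (hiw t h)).trans h.symm

/-! ### Deformation of maps into the 4-point model -/

instance : DecidableLT Kun := decidableLTOfDecidableLE

/-- A contraction, above `p₅`, of the set of points below `x`. -/
def towardsP₅ : Kun → Kun
  | z => p₁
  | w => p₂
  | a => a

/-- A contraction, above `p₆`, of the set of points below `y`. -/
def towardsP₆ : Kun → Kun
  | z => p₃
  | w => p₄
  | a => a

/-- The retraction of the complement of `{x, y}` to the 4-point model `{x', y', z', w'}`. -/
def toModel : Kun → Kun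
  | z | w => z'
  | p₅ | p₆ => w'
  | p₁ | p₄ => x'
  | p₂ | p₃ => y'
  | a => a

/-- The values over `D` lie in the model, so removing `x` and `y` and then applying `toModel` leaves
`g` unchanged there. -/
theorem hasRelativeLifts_ofCircle : HasRelativeLifts ofCircle := by
  intro T _ D hD g l hl hlg
  have hgD : ∀ t ∈ D, g t = x' ∨ g t = y' ∨ g t = z' ∨ g t = w' := fun t ht => by
    rw [← hlg t ht]
    simp only [ofCircle, ContinuousMap.coe_mk]
    split_ifs <;> simp
  obtain ⟨g₁, hg₁, hx₁, -⟩ := g.exists_homotopicRel_ne (a := x) (c := p₅) (r := towardsP₅)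
    (isMax_of_mem (by decide)) (by decide) (by decide) (by decide) hD
    (fun t ht => by rcases hgD t ht with h | h | h | h <;> simp [h])
  obtain ⟨g₂, hg₂, hy₂, hg₂'⟩ := g₁.exists_homotopicRel_ne (a := y) (c := p₆) (r := towardsP₆)
    (isMax_of_mem (by decide)) (by decide) (by decide) (by decide) hD
    (fun t ht => by
      rw [hg₁.fst_eq_snd ht]
      rcases hgD t ht with h | h | h | h <;> simp [h])
  -- Removing `y` does not bring `x` back: the new values are `p₆` or in the image of `towardsP₆`
  -- below `y`.
  have hx₂ : ∀ t, g₂ t ≠ x := fun t => by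
    rcases hg₂' t with h | h | ⟨h, h'⟩
    · exact h ▸ hx₁ t
    · simp [h]
    · rw [h']
      have : ∀ b < y, towardsP₆ b ≠ x := by decide
      exact this _ h
  have hgD₂ : Set.EqOn g₂ g D := fun t ht => (hg₂.trans hg₁).fst_eq_snd ht
  let g₃ : C(T, Kun) := ⟨fun t => toModel (g₂ t), continuous_iff_eventually_le.2 fun t => by
    filter_upwards [g₂.eventually_le t] with s hs
    have : ∀ a, a ≠ x → a ≠ y → ∀ b ≤ a, toModel b ≤ toModel a := by decide
    exact this _ (hx₂ t) (hy₂ t) _ hs⟩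
  have hg₃D : Set.EqOn g₂ g₃ D := fun t ht => by
    change g₂ t = toModel (g₂ t)
    rw [hgD₂ ht]
    rcases hgD t ht with h | h | h | h <;> rw [h] <;> rfl
  have hg₃ : g₂.HomotopicRel g₃ D := by
    refine ContinuousMap.homotopicRel_of_le (fun t => ?_) hg₃D
    have : ∀ a, a ≠ x → a ≠ y → a ≤ toModel a := by decide
    exact this _ (hx₂ t) (hy₂ t)
  obtain ⟨v, hvl, hv⟩ := exists_lift_circle hD g₃
    (fun t => by
      have : ∀ a, a ≠ x → a ≠ y →
          toModel a = x' ∨ toModel a = y' ∨ toModel a = z' ∨ toModel a = w' := by decide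
      exact this _ (hx₂ t) (hy₂ t)) hl
    (fun t ht => by rw [hlg t ht, ← hgD₂ ht, hg₃D ht])
  exact ⟨v, hvl, hv ▸ hg₃.symm.trans (hg₂.trans hg₁)⟩

theorem weakHomotopyEquivalent_circle : WeakHomotopyEquivalent Kun Circle :=
  .symm _ _ (.rel _ _ ⟨ofCircle, hasRelativeLifts_ofCircle.isWeakHomotopyEquivalence⟩)

instance : T0Space Kun :=
  ⟨fun _ _ h => le_antisymm (Topology.IsLowerSet.specializes_iff_le.1 h.specializes)
    (Topology.IsLowerSet.specializes_iff_le.1 h.specializes')⟩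

end Kun

/-- The 14-point finite `T₀`-space `Kun` is weak homotopy equivalent to the circle `S¹` and has
the fixed point property. -/
theorem lemma4 :
    Nat.card Kun = 14 ∧ T0Space Kun ∧ WeakHomotopyEquivalent Kun Circle ∧
      FixedPointProperty Kun :=
  ⟨by rw [Nat.card_eq_fintype_card]; rfl, inferInstance, Kun.weakHomotopyEquivalent_circle,
    Kun.fixedPointProperty⟩
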